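/- Consider finite undirected graphs, not necessarily simple (parallel edges and loops are allowed, every edge, loops included, has two orientations, and a loop contributes $2$ to the degree of its vertex), with at least one vertex and with minimum degree at least $3$. An orientation of such a graph $G$ is sink-free if every vertex has at least one outgoing edge. There exist a randomised algorithm and an absolute constant $C$ such that the following holds. For every such graph $G$ with $m$ edges and every real $0<\varepsilon<1$, $G$ has a sink-free orientation, and the algorithm, given the list of edges of $G$ and the binary digits of $\varepsilon$, always halts within $C\,m\log(m/\varepsilon)$ steps and outputs a random orientation $\sigma$ of $G$ whose distribution $\nu$ satisfies $$d_{\mathrm{TV}}(\nu,\mu)=\frac12\sum_{\tau}|\nu(\tau)-\mu(\tau)|\le\varepsilon,$$ where $\mu$ is the uniform distribution on the sink-free orientations of $G$ and the sum is over all orientations $\tau$ of $G$. Here the algorithm is a single program for a random access machine with fair coin tosses, in which every elementary instruction (assignment, increment or decrement of a register, array access, comparison, coin toss) takes one step. -/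

import Mathlib

/-! ## Graphs, orientations, sinks -/

/-- A finite undirected multigraph on the vertices `0, …, n-1` with edges `0, …, m-1`, presented
as a list of edges. Parallel edges and loops are allowed. The order of the two endpoints of an edge
carries no information about the graph: it only serves to name the two directions of the edge. -/
structure EdgeListGraph (n m : ℕ) where
  fst : Fin m → Fin n
  snd : Fin m → Fin n

namespace EdgeListGraph

variable {n m : ℕ}

/-- The degree of a vertex; a loop counts twice. -/
def degree (G : EdgeListGraph n m) (v : Fin n) : ℕ :=
  (Finset.univ.filter fun e => G.fst e = v).card + (Finset.univ.filter fun e => G.snd e = v).card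

/-- An orientation chooses one of the two directions of each edge:
`true` directs `e` from `fst e` to `snd e`, and `false` directs it from `snd e` to `fst e`. -/
abbrev Orientation (_G : EdgeListGraph n m) : Type := Fin m → Bool

/-- The vertex that the edge `e` leaves in the orientation `σ`. -/
def tail (G : EdgeListGraph n m) (σ : G.Orientation) (e : Fin m) : Fin n :=
  if σ e then G.fst e else G.snd e

/-- A sink is a vertex without outgoing edges. -/
def IsSink (G : EdgeListGraph n m) (σ : G.Orientation) (v : Fin n) : Prop :=
  ∀ e, G.tail σ e ≠ v

open Classical in
/-- The set of sink-free orientations. -/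
noncomputable def sinkFree (G : EdgeListGraph n m) : Finset G.Orientation :=
  Finset.univ.filter fun σ => ∀ v, ¬ G.IsSink σ v

end EdgeListGraph

/-- Total variation distance of two distributions on a finite set. -/
noncomputable def tvDist {α : Type*} [Fintype α] (p q : PMF α) : ℝ :=
  (∑ x, |(p x).toReal - (q x).toReal|) / 2

/-! ## A randomised random access machine with unit costs

The machine has scalar registers and arrays, both named by natural numbers, that hold natural
numbers; a program, being finite, mentions finitely many of them. The only arithmetic operations
are `+ 1` and `- 1`, so that after `t` steps no number exceeds the largest number of the program
and of the input by more than `t`: charging one unit per operation hides no work on long numbers. -/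

namespace RAM

/-- The contents of the memory. -/
structure Store where
  reg : ℕ → ℕ
  arr : ℕ → ℕ → ℕ

/-- `x := a` -/
def Store.setReg (s : Store) (x a : ℕ) : Store :=
  { s with reg := Function.update s.reg x a }

/-- `A[i] := a`, where `A` is the array with name `j`. -/
def Store.setArr (s : Store) (j i a : ℕ) : Store :=
  { s with arr := Function.update s.arr j (Function.update (s.arr j) i a) }

/-- Comparisons of two registers. -/
inductive Test where
  | eq (x y : ℕ)
  | ne (x y : ℕ)
  | lt (x y : ℕ)
  | le (x y : ℕ)

/-- The outcome of a comparison. -/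
def Test.eval (s : Store) : Test → Bool
  | .eq x y => decide (s.reg x = s.reg y)
  | .ne x y => decide (s.reg x ≠ s.reg y)
  | .lt x y => decide (s.reg x < s.reg y)
  | .le x y => decide (s.reg x ≤ s.reg y)

/-- Programs. -/
inductive Program where
  /-- do nothing -/
  | skip
  /-- `x := a` for a constant `a` -/
  | const (x a : ℕ)
  /-- `x := y` -/
  | copy (x y : ℕ)
  /-- `x := x + 1` -/
  | inc (x : ℕ)
  /-- `x := x - 1`, and `0` stays `0` -/
  | dec (x : ℕ)
  /-- `x := A[i]`, where `A` is the array with name `j` and `i` is the content of register `y` -/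
  | load (x j y : ℕ)
  /-- `A[i] := x`, where `A` is the array with name `j` and `i` is the content of register `y` -/
  | store (j y x : ℕ)
  /-- `x` becomes the result in `{0, 1}` of a fresh toss of a fair coin -/
  | flip (x : ℕ)
  /-- first `p`, then `q` -/
  | seq (p q : Program)
  /-- conditional -/
  | ite (b : Test) (p q : Program)
  /-- loop -/
  | while (b : Test) (p : Program)

/-- A configuration: what remains to be executed, first item first, and the memory. -/
abbrev Config : Type := List Program × Store

/-- The machine has halted when nothing remains to be executed. -/
def Halted (c : Config) : Prop := c.1 = []

/-- One step of the machine, as a distribution on the next configuration. Each elementary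
instruction, each evaluation of a test and each unfolding of `seq` takes one step. -/
noncomputable def step : Config → PMF Config
  | ([], s) => PMF.pure ([], s)
  | (.skip :: k, s) => PMF.pure (k, s)
  | (.const x a :: k, s) => PMF.pure (k, s.setReg x a)
  | (.copy x y :: k, s) => PMF.pure (k, s.setReg x (s.reg y))
  | (.inc x :: k, s) => PMF.pure (k, s.setReg x (s.reg x + 1))
  | (.dec x :: k, s) => PMF.pure (k, s.setReg x (s.reg x - 1))
  | (.load x j y :: k, s) => PMF.pure (k, s.setReg x (s.arr j (s.reg y)))
  | (.store j y x :: k, s) => PMF.pure (k, s.setArr j (s.reg y) (s.reg x))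
  | (.flip x :: k, s) => (PMF.uniformOfFintype Bool).map fun b => (k, s.setReg x b.toNat)
  | (.seq p q :: k, s) => PMF.pure (p :: q :: k, s)
  | (.ite b p q :: k, s) => PMF.pure ((if b.eval s then p else q) :: k, s)
  | (.while b p :: k, s) => PMF.pure (if b.eval s then p :: .while b p :: k else k, s)

/-- The distribution of the configuration after `t` steps. -/
noncomputable def run : ℕ → Config → PMF Config
  | 0, c => PMF.pure c
  | t + 1, c => (step c).bind (run t)

end RAM

/-! ## Input and output of a sampling algorithm -/

namespace EdgeListGraph

variable {n m : ℕ}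

/-- The initial memory for the graph `G` and the accuracy `ε ∈ (0, 1)`: registers `0` and `1` hold
`n` and `m`, arrays `0` and `1` hold the list of edges, and array `2` holds the digits after the
point of the binary expansion of `ε`. Everything else is `0`. -/
noncomputable def input (G : EdgeListGraph n m) (ε : ℝ) : RAM.Store where
  reg
    | 0 => n
    | 1 => m
    | _ => 0
  arr
    | 0 => fun e => if h : e < m then (G.fst ⟨e, h⟩ : ℕ) else 0
    | 1 => fun e => if h : e < m then (G.snd ⟨e, h⟩ : ℕ) else 0
    | 2 => fun i => (Real.digits ε 2 i : ℕ)
    | _ => fun _ => 0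

/-- The orientation that is read off from the final memory: array `3` holds a nonzero entry
for the edges directed from `fst` to `snd`, and a zero for the other edges. -/
def output (G : EdgeListGraph n m) (c : RAM.Config) : G.Orientation :=
  fun e => decide (c.2.arr 3 e ≠ 0)

/-- The distribution of the output of the program `p` on `G` and `ε`, read after `t` steps. -/
noncomputable def outputDist (G : EdgeListGraph n m) (ε : ℝ) (p : RAM.Program) (t : ℕ) :
    PMF G.Orientation :=
  (RAM.run t ([p], G.input ε)).map G.output

end EdgeListGraph

/-! ## Rules for running programs -/

namespace RAM

variable {α : Type*}

/-! The algorithm is parallel sink popping: draw a uniform orientation, then repeatedly resample,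
all at once, the edges that enter sinks. Given that the set of sinks is J, a round produces the
uniform distribution on the orientations without sinks outside the closed neighbourhood N[J]
(`sum_popSinks_mul_card`). So, conditionally on J, the process restarts from a distribution of the
same kind, uniform on `sinkFreeOn S` with S the complement of N[J], and it remains to see Sᶜ shrink.

A local-lemma induction (`pow_mul_card_le`) bounds the probability that v is a sink, given that S
contains none, by 2^(-d) (5/4)^|S ∩ N(v)|, where d is the degree of v. The sets S that arise are
open-ended, so |S ∩ N(v)| ≤ d - 1, and d + 1 times the probability is at most 25/32 for every d ≥ 3.
Summed over v outside S, the expected size of the next N[J] is at most 25/32 |Sᶜ|. By induction on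
R, each sink-free orientation has probability at least (1 - (25/32)^R n) / |Ω| after R rounds, where
Ω is the set of sink-free orientations (`card_mul_le_sum_iterate`). Such lower bounds alone control
the total variation distance (`tvDist_le_of_mul_le`).

Three rounds more than halve the error, so 3(⌈log₂ n⌉ + D + 1) rounds suffice, where D is the number
of leading binary zeros of ε, and a round costs O(m). The program is analysed backwards with
`Attains`: a lower bound f for the probability of a fixed output after a round becomes `popSinks f`
before it. -/

theorem run_succ (t : ℕ) (c : Config) : run (t + 1) c = (step c).bind (run t) := rfl

theorem run_halted (t : ℕ) (s : Store) : run t ([], s) = PMF.pure ([], s) := by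
  induction t with
  | zero => rfl
  | succ t ih => rw [run_succ, step, PMF.pure_bind, ih]

theorem run_add (t u : ℕ) (c : Config) : run (t + u) c = (run t c).bind (run u) := by
  induction t generalizing c with
  | zero => rw [zero_add, run, PMF.pure_bind]
  | succ t ih =>
    rw [Nat.succ_add, run_succ, run_succ, PMF.bind_bind]
    exact congrArg _ (funext ih)

/-- Started from `c`, the machine always halts within `T` steps, and the probability that the
observable `o` of the final configuration equals `a` is at least `g`. -/
def Attains (o : Config → α) (a : α) (T : ℕ) (c : Config) (g : ℝ) : Prop :=
  (∀ c' ∈ (run T c).support, Halted c') ∧ ENNReal.ofReal g ≤ ((run T c).map o) a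

variable {o : Config → α} {a : α} {T U : ℕ} {g : ℝ} {k : List Program} {s : Store}

/-- A halted configuration is fixed by `step`, so extra time changes nothing. This allows branches
of different lengths to be padded to a common time bound. -/
theorem Attains.mono {c : Config} (H : Attains o a T c g) (h : T ≤ U) : Attains o a U c g := by
  obtain ⟨d, rfl⟩ := Nat.exists_eq_add_of_le h
  have key : run (T + d) c = run T c := by
    rw [run_add]
    conv_rhs => rw [← PMF.bind_pure (run T c)]
    ext x
    rw [PMF.bind_apply, PMF.bind_apply]
    refine tsum_congr fun c' => ?_
    by_cases hc : c' ∈ (run T c).support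
    · obtain ⟨l, s⟩ := c'
      obtain rfl : l = [] := H.1 _ hc
      rw [run_halted]
    · rw [(PMF.apply_eq_zero_iff _ _).2 hc, zero_mul, zero_mul]
  rw [Attains, key]
  exact H

theorem Attains.halted (h : ENNReal.ofReal g ≤ (PMF.pure (o ([], s))) a) :
    Attains o a T ([], s) g := by
  refine ⟨fun c' hc => ?_, ?_⟩
  · rw [run_halted, PMF.support_pure, Set.mem_singleton_iff] at hc
    rw [hc]; rfl
  · rw [run_halted, PMF.pure_map]
    exact h

theorem attains_of_step {c c' : Config} (h : step c = PMF.pure c') (H : Attains o a T c' g) :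
    Attains o a (T + 1) c g := by
  rw [Attains, run_succ, h, PMF.pure_bind]
  exact H

theorem attains_const {x b : ℕ} (H : Attains o a T (k, s.setReg x b) g) :
    Attains o a (T + 1) (.const x b :: k, s) g := attains_of_step (by rw [step]) H

theorem attains_copy {x y : ℕ} (H : Attains o a T (k, s.setReg x (s.reg y)) g) :
    Attains o a (T + 1) (.copy x y :: k, s) g := attains_of_step (by rw [step]) H

theorem attains_inc {x : ℕ} (H : Attains o a T (k, s.setReg x (s.reg x + 1)) g) :
    Attains o a (T + 1) (.inc x :: k, s) g := attains_of_step (by rw [step]) H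

theorem attains_dec {x : ℕ} (H : Attains o a T (k, s.setReg x (s.reg x - 1)) g) :
    Attains o a (T + 1) (.dec x :: k, s) g := attains_of_step (by rw [step]) H

theorem attains_load {x j y : ℕ} (H : Attains o a T (k, s.setReg x (s.arr j (s.reg y))) g) :
    Attains o a (T + 1) (.load x j y :: k, s) g := attains_of_step (by rw [step]) H

theorem attains_store {j y x : ℕ} (H : Attains o a T (k, s.setArr j (s.reg y) (s.reg x)) g) :
    Attains o a (T + 1) (.store j y x :: k, s) g := attains_of_step (by rw [step]) H

theorem attains_skip (H : Attains o a T (k, s) g) :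
    Attains o a (T + 1) (.skip :: k, s) g := attains_of_step (by rw [step]) H

theorem attains_seq {p q : Program} (H : Attains o a T (p :: q :: k, s) g) :
    Attains o a (T + 1) (.seq p q :: k, s) g := attains_of_step (by rw [step]) H

theorem attains_ite_true {b : Test} {p q : Program} (hb : b.eval s = true)
    (H : Attains o a T (p :: k, s) g) : Attains o a (T + 1) (.ite b p q :: k, s) g :=
  attains_of_step (by rw [step, if_pos hb]) H

theorem attains_ite_false {b : Test} {p q : Program} (hb : b.eval s = false)
    (H : Attains o a T (q :: k, s) g) : Attains o a (T + 1) (.ite b p q :: k, s) g :=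
  attains_of_step (by rw [step, if_neg (by simp [hb])]) H

theorem attains_while_true {b : Test} {p : Program} (hb : b.eval s = true)
    (H : Attains o a T (p :: .while b p :: k, s) g) :
    Attains o a (T + 1) (.while b p :: k, s) g :=
  attains_of_step (by rw [step, if_pos hb]) H

theorem attains_while_false {b : Test} {p : Program} (hb : b.eval s = false)
    (H : Attains o a T (k, s) g) : Attains o a (T + 1) (.while b p :: k, s) g :=
  attains_of_step (by rw [step, if_neg (by simp [hb])]) H

/-- The two outcomes may carry different bounds; their mean is what builds up `average` along the
resampling loop. -/
theorem attains_flip {x : ℕ} {h : ℝ} (H₁ : Attains o a T (k, s.setReg x 1) g)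
    (H₀ : Attains o a T (k, s.setReg x 0) h) :
    Attains o a (T + 1) (.flip x :: k, s) ((g + h) / 2) := by
  have key : run (T + 1) (.flip x :: k, s) = (PMF.uniformOfFintype Bool).bind fun b =>
      run T (k, s.setReg x b.toNat) := by
    rw [run_succ, step, PMF.bind_map]; rfl
  rw [Attains, key]
  constructor
  · intro c' hc
    obtain ⟨b, -, hb⟩ := (PMF.mem_support_bind_iff _ _ _).1 hc
    cases b
    · exact H₀.1 _ hb
    · exact H₁.1 _ hb
  · rw [PMF.map_bind, PMF.bind_apply, tsum_fintype, Fintype.sum_bool]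
    simp only [PMF.uniformOfFintype_apply, Fintype.card_bool, Bool.toNat_true, Bool.toNat_false,
      ← mul_add]
    calc ENNReal.ofReal ((g + h) / 2) = (2 : ENNReal)⁻¹ * ENNReal.ofReal (g + h) := by
          rw [div_eq_inv_mul, ENNReal.ofReal_mul (by norm_num)]
          congr 1
          rw [ENNReal.ofReal_inv_of_pos (by norm_num)]; norm_num
      _ ≤ _ := by
          gcongr
          · norm_num
          · exact ENNReal.ofReal_add_le.trans (add_le_add H₁.2 H₀.2)

end RAM

/-! ## Resampling a set of edges -/

namespace EdgeListGraph

variable {n m : ℕ}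

/-- The vertex that the edge `e` enters in the orientation `σ`. -/
def head (G : EdgeListGraph n m) (σ : G.Orientation) (e : Fin m) : Fin n :=
  if σ e then G.snd e else G.fst e

/-- The function that agrees with `ρ` on `D` and with `σ` elsewhere. -/
def mix (D : Finset (Fin m)) (σ ρ : Fin m → Bool) : Fin m → Bool :=
  fun e => if e ∈ D then ρ e else σ e

/-- The mean of `f` when the values of `σ` on `D` are resampled. -/
noncomputable def average (D : Finset (Fin m)) (f : (Fin m → Bool) → ℝ) (σ : Fin m → Bool) : ℝ :=
  (∑ ρ, f (mix D σ ρ)) / 2 ^ m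

theorem average_empty (f : (Fin m → Bool) → ℝ) (σ : Fin m → Bool) : average ∅ f σ = f σ := by
  have h : ∀ ρ, mix ∅ σ ρ = σ := fun ρ => by simp [mix, funext_iff]
  simp [average, h]

theorem average_univ (f : (Fin m → Bool) → ℝ) (σ : Fin m → Bool) :
    average Finset.univ f σ = (∑ ρ, f ρ) / 2 ^ m := by
  have h : ∀ ρ, mix Finset.univ σ ρ = ρ := fun ρ => by simp [mix, funext_iff]
  simp [average, h]

/-- The summand is `H (ρ e) ρ`, where `H b` ignores the value of `ρ` at `e`. Flipping that value
shows that `ρ e` and `!ρ e` give the same sum, and together they account for both constant choices.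
-/
theorem average_insert {D : Finset (Fin m)} {e : Fin m} (he : e ∉ D) (f : (Fin m → Bool) → ℝ)
    (σ : Fin m → Bool) :
    average (insert e D) f σ = (average D f (Function.update σ e true) +
      average D f (Function.update σ e false)) / 2 := by
  let H : Bool → (Fin m → Bool) → ℝ := fun b ρ => f (mix D (Function.update σ e b) ρ)
  let φ : (Fin m → Bool) → (Fin m → Bool) := fun ρ => Function.update ρ e (!ρ e)
  have hφ : Function.Involutive φ := fun ρ => by
    ext e'
    by_cases h : e' = e
    · subst h; simp [φ]
    · simp [φ, h]
  have hH : ∀ b ρ, H b (φ ρ) = H b ρ := fun b ρ => by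
    refine congrArg f (funext fun e' => ?_)
    by_cases h : e' = e
    · subst h; simp [mix, he]
    · simp [mix, φ, h]
  have h₁ : ∀ ρ, f (mix (insert e D) σ ρ) = H (ρ e) ρ := fun ρ => by
    refine congrArg f (funext fun e' => ?_)
    by_cases h : e' = e
    · subst h; simp [mix, he]
    · simp [mix, h]
  have h₂ : ∑ ρ, H (ρ e) ρ = ∑ ρ, H (!ρ e) ρ := by
    rw [← Equiv.sum_comp (hφ.toPerm φ)]
    refine Finset.sum_congr rfl fun ρ _ => ?_
    change H (φ ρ e) (φ ρ) = _
    rw [hH]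
    simp [φ]
  have h₃ : ∑ ρ, H (ρ e) ρ + ∑ ρ, H (!ρ e) ρ = ∑ ρ, H true ρ + ∑ ρ, H false ρ := by
    rw [← Finset.sum_add_distrib, ← Finset.sum_add_distrib]
    refine Finset.sum_congr rfl fun ρ _ => ?_
    cases ρ e
    · exact add_comm _ _
    · rfl
  rw [average, average, average, ← add_div, Finset.sum_congr rfl fun ρ _ => h₁ ρ]
  change _ = (∑ ρ, H true ρ + ∑ ρ, H false ρ) / 2 ^ m / 2
  rw [← h₃, ← h₂]
  ring

open Classical in
/-- The edges that enter sinks. -/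
noncomputable def sinkEdges (G : EdgeListGraph n m) (σ : G.Orientation) : Finset (Fin m) :=
  Finset.univ.filter fun e => G.IsSink σ (G.head σ e)

/-- The mean of `f` after one round, which resamples all edges that enter sinks. -/
noncomputable def popSinks (G : EdgeListGraph n m) (f : G.Orientation → ℝ) (σ : G.Orientation) :
    ℝ :=
  average (G.sinkEdges σ) f σ

end EdgeListGraph

/-! ## The program -/

namespace SinkPopping

open RAM EdgeListGraph

/-- Execute the programs of a list one after the other. -/
def block : List Program → Program
  | [] => .skip
  | p :: l => .seq p (block l)

/-- Registers `3`, `4`, `5` are temporary, register `2` remains `0`. A vertex `v` is marked when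
entry `v` of array `4` is nonzero. -/
def resampleBody : Program :=
  block [.load 4 3 3, .ite (.eq 4 2) (.load 5 0 3) (.load 5 1 3), .load 5 4 5,
    .ite (.eq 5 2) (block [.flip 4, .store 3 3 4]) .skip, .inc 3]

/-- Toss a coin for every edge whose head is not marked. -/
def resample : Program := block [.const 3 0, .while (.lt 3 1) resampleBody]

def unmarkBody : Program := block [.store 4 3 2, .inc 3]

/-- Unmark all vertices. -/
def unmark : Program := block [.const 3 0, .while (.lt 3 0) unmarkBody]

/-- The mark is the content `m` of register `1`, which is nonzero as soon as there is an edge. -/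
def markBody : Program :=
  block [.load 4 3 3, .ite (.eq 4 2) (.load 5 1 3) (.load 5 0 3), .store 4 5 1, .inc 3]

/-- Mark the tails of all edges. -/
def mark : Program := block [.const 3 0, .while (.lt 3 1) markBody]

/-- One round, which resamples all edges that enter sinks. -/
def round : Program := block [.dec 6, unmark, mark, resample]

/-- Three rounds multiply the error by (25/32)^3 < 1/2, so each binary digit of accuracy costs three
rounds. -/
def addThree : Program := block [.inc 6, .inc 6, .inc 6]

/-- Addition by unit steps: with register `8` starting as a copy of register `7`, the loop doubles
register `7`. -/
def doubleBody : Program := block [.inc 7, .dec 8]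

/-- Add `3 ⌈log₂ n⌉` to register `6`. -/
def countVertices : Program :=
  block [.const 7 1, .while (.lt 7 0) (block [.copy 8 7, .while (.ne 8 2) doubleBody, addThree])]

/-- Add three times the number of leading zeros of `ε` to register `6`. -/
def countDigits : Program :=
  block [.load 4 2 3, .while (.eq 4 2) (block [.inc 3, addThree, .load 4 2 3])]

/-- The sampling program; register `6` counts the remaining rounds. -/
def program : Program :=
  block [countVertices, countDigits, addThree, resample, .while (.ne 6 2) round]

/-! ### Lower bounds for the loops that make up the rounds. -/

variable {n m : ℕ} {G : EdgeListGraph n m} {α : Type*} {o : Config → α} {a : α}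

/-- The memory `s` holds the graph `G`, the orientation `σ` and the number `r` of rounds. -/
structure Holds (G : EdgeListGraph n m) (r : ℕ) (σ : G.Orientation) (s : Store) : Prop where
  vertices : s.reg 0 = n
  edges : s.reg 1 = m
  zero : s.reg 2 = 0
  rounds : s.reg 6 = r
  fst : ∀ e : Fin m, s.arr 0 e = G.fst e
  snd : ∀ e : Fin m, s.arr 1 e = G.snd e
  orientation : ∀ e : Fin m, s.arr 3 e = (σ e).toNat

/-- The marks stay fixed during the loop, and a toss for an edge changes no other edge. Hence the
edges still to be resampled are the same whether heads are read in the original or in the updated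
orientation. -/
theorem attains_while_resample {r i j T : ℕ} {σ : G.Orientation} {J : Finset (Fin n)} {s : Store}
    {k : List Program} {f : G.Orientation → ℝ} (hs : Holds G r σ s) (hi : s.reg 3 = i)
    (hij : i + j = m) (hJ : ∀ v : Fin n, s.arr 4 v = 0 ↔ v ∈ J)
    (H : ∀ ρ s', Holds G r ρ s' → Attains o a T (k, s') (f ρ)) :
    Attains o a (T + (20 * j + 1)) (.while (.lt 3 1) resampleBody :: k, s)
      (average (Finset.univ.filter fun e => i ≤ e.val ∧ G.head σ e ∈ J) f σ) := by
  induction j generalizing i σ s with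
  | zero =>
    rw [Finset.filter_false_of_mem, average_empty]
    · exact attains_while_false (by simp [Test.eval, hs.edges, hi]; omega) (H _ _ hs)
    · intro e _ he
      have := e.isLt
      omega
  | succ j ih =>
    have him : i < m := by omega
    obtain ⟨e, rfl⟩ : ∃ e : Fin m, e.val = i := ⟨⟨i, him⟩, rfl⟩
    refine Attains.mono (T := (T + (20 * j + 1)) + 19 + 1) ?_ (by omega)
    refine attains_while_true (by simp [Test.eval, hs.edges, hi]) ?_
    refine attains_seq (attains_load (attains_seq ?_))
    suffices hh : ∀ s' : Store, Holds G r σ s' → s'.arr = s.arr → s'.reg 3 = e →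
        s'.reg 5 = G.head σ e →
        Attains o a (T + (20 * j + 1) + 13) ((block [.load 5 4 5,
          .ite (.eq 5 2) (block [.flip 4, .store 3 3 4]) .skip, .inc 3]) ::
            .while (.lt 3 1) resampleBody :: k, s')
          (average (Finset.univ.filter fun e' => e.val ≤ e'.val ∧ G.head σ e' ∈ J) f σ) by
      have h3 := hs.orientation e
      by_cases hσ : σ e
      · refine attains_ite_false (by simp [Test.eval, Store.setReg, hs.zero, hi, h3, hσ]) ?_
        refine attains_load (Attains.mono (hh _ ?_ rfl ?_ ?_) (by omega))
        · constructor <;> simp [Store.setReg, hs.1, hs.2, hs.3, hs.4, hs.5, hs.6, hs.7]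
        · simp [Store.setReg, hi]
        · simp [Store.setReg, hi, hs.snd, head, hσ]
      · refine attains_ite_true (by simp [Test.eval, Store.setReg, hs.zero, hi, h3, hσ]) ?_
        refine attains_load (Attains.mono (hh _ ?_ rfl ?_ ?_) (by omega))
        · constructor <;> simp [Store.setReg, hs.1, hs.2, hs.3, hs.4, hs.5, hs.6, hs.7]
        · simp [Store.setReg, hi]
        · simp [Store.setReg, hi, hs.fst, head, hσ]
    clear hi
    intro s' hs' harr hi h5
    rw [← harr] at hJ
    clear harr hs s
    refine attains_seq (attains_load (attains_seq ?_))
    by_cases hv : G.head σ e ∈ J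
    · have h4 := (hJ _).2 hv
      refine attains_ite_true (by simp [Test.eval, Store.setReg, hs'.zero, h5, h4]) ?_
      have hset : (Finset.univ.filter fun e' => e.val ≤ e'.val ∧ G.head σ e' ∈ J) =
          insert e (Finset.univ.filter fun e' => e.val + 1 ≤ e'.val ∧ G.head σ e' ∈ J) := by
        ext e'
        by_cases h : e' = e
        · subst h; simp [hv]
        · have : e'.val ≠ e.val := fun h' => h (Fin.ext h')
          simp only [Finset.mem_filter, Finset.mem_univ, true_and, Finset.mem_insert, h, false_or]
          exact and_congr_left fun _ => by omega
      have hupd : ∀ b, (Finset.univ.filter fun e' => e.val + 1 ≤ e'.val ∧ G.head σ e' ∈ J) =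
          (Finset.univ.filter fun e' => e.val + 1 ≤ e'.val ∧
            G.head (Function.update σ e b) e' ∈ J) := fun b => by
        refine Finset.filter_congr fun e' _ => and_congr_right fun h => ?_
        have : e' ≠ e := fun h' => by subst h'; omega
        simp [head, this]
      rw [hset, average_insert (by simp)]
      suffices hb : ∀ b : Bool, Attains o a (T + (20 * j + 1) + 7) (block [.store 3 3 4] ::
          block [.inc 3] :: .while (.lt 3 1) resampleBody :: k,
            (s'.setReg 5 (s'.arr 4 (s'.reg 5))).setReg 4 b.toNat)
          (average (Finset.univ.filter fun e' => e.val + 1 ≤ e'.val ∧ G.head σ e' ∈ J) f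
            (Function.update σ e b)) from
        attains_seq (attains_flip (hb true) (hb false))
      intro b
      rw [hupd b]
      refine attains_seq (attains_store (attains_skip (attains_seq (attains_inc
        (attains_skip ?_)))))
      refine Attains.mono (ih ?_ ?_ (by omega) ?_) (Nat.le_add_right _ 1)
      · constructor <;> simp [Store.setReg, Store.setArr, hs'.1, hs'.2, hs'.3, hs'.4, hs'.5,
          hs'.6, hi]
        intro e'
        by_cases h : e' = e
        · subst h; simp
        · have : e'.val ≠ e.val := fun h' => h (Fin.ext h')
          simp [h, this, hs'.7]
      · simp [Store.setReg, Store.setArr, hi]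
      · simpa [Store.setReg, Store.setArr] using hJ
    · have h4 := mt (hJ _).1 hv
      refine attains_ite_false (by simp [Test.eval, Store.setReg, hs'.zero, h5, h4]) ?_
      have hset : (Finset.univ.filter fun e' => e.val ≤ e'.val ∧ G.head σ e' ∈ J) =
          (Finset.univ.filter fun e' => e.val + 1 ≤ e'.val ∧ G.head σ e' ∈ J) := by
        ext e'
        by_cases h : e' = e
        · subst h; simp [hv]
        · have : e'.val ≠ e.val := fun h' => h (Fin.ext h')
          simp only [Finset.mem_filter, Finset.mem_univ, true_and]
          exact and_congr_left fun _ => by omega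
      rw [hset]
      refine attains_skip (attains_seq (attains_inc (attains_skip ?_)))
      refine Attains.mono (ih ?_ ?_ (by omega) ?_) (by omega)
      · constructor <;> simp [Store.setReg, hs'.1, hs'.2, hs'.3, hs'.4, hs'.5, hs'.6, hs'.7]
      · simp [Store.setReg, hi]
      · simpa [Store.setReg] using hJ

theorem attains_resample {r T : ℕ} {σ : G.Orientation} {J : Finset (Fin n)} {s : Store}
    {k : List Program} {f : G.Orientation → ℝ} (hs : Holds G r σ s)
    (hJ : ∀ v : Fin n, s.arr 4 v = 0 ↔ v ∈ J)
    (H : ∀ ρ s', Holds G r ρ s' → Attains o a T (k, s') (f ρ)) :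
    Attains o a (T + (20 * m + 5)) (resample :: k, s)
      (average (Finset.univ.filter fun e => G.head σ e ∈ J) f σ) := by
  refine Attains.mono (T := (T + 1) + (20 * m + 1) + 3) ?_ (by omega)
  refine attains_seq (attains_const (attains_seq ?_))
  have := attains_while_resample (o := o) (a := a) (G := G) (r := r) (i := 0) (j := m) (T := T + 1)
    (σ := σ) (J := J) (s := s.setReg 3 0) (k := block [] :: k) (f := f)
    (by constructor <;> simp [Store.setReg, hs.1, hs.2, hs.3, hs.4, hs.5, hs.6, hs.7])
    (by simp [Store.setReg]) (by omega) (by simpa [Store.setReg] using hJ)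
    (fun ρ s' h => attains_skip (H ρ s' h))
  simpa using this

theorem attains_while_unmark {r i j T : ℕ} {σ : G.Orientation} {s : Store}
    {k : List Program} {g : ℝ} (hs : Holds G r σ s) (hi : s.reg 3 = i)
    (hij : i + j = n) (h4 : ∀ v < i, s.arr 4 v = 0)
    (H : ∀ s', Holds G r σ s' → (∀ v : Fin n, s'.arr 4 v = 0) → Attains o a T (k, s') g) :
    Attains o a (T + (6 * j + 1)) (.while (.lt 3 0) unmarkBody :: k, s) g := by
  induction j generalizing i s with
  | zero =>
    refine attains_while_false (by simp [Test.eval, hs.vertices, hi]; omega) (H _ hs fun v => ?_)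
    exact h4 v (by omega)
  | succ j ih =>
    refine Attains.mono (T := (T + (6 * j + 1)) + 5 + 1) ?_ (by omega)
    refine attains_while_true (by simp [Test.eval, hs.vertices, hi]; omega) ?_
    refine attains_seq (attains_store (attains_seq (attains_inc (attains_skip ?_))))
    refine ih (i := i + 1) ?_ ?_ (by omega) ?_
    · constructor <;> simp [Store.setReg, Store.setArr, hs.1, hs.2, hs.3, hs.4, hs.5, hs.6, hs.7]
    · simp [Store.setReg, Store.setArr, hi]
    · intro v hv
      by_cases h : v = i
      · subst h; simp [Store.setReg, Store.setArr, hi, hs.zero]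
      · simp [Store.setReg, Store.setArr, hi, h, h4 v (by omega)]

theorem attains_while_mark {r i j T : ℕ} {σ : G.Orientation} {s : Store}
    {k : List Program} {g : ℝ} (hs : Holds G r σ s) (hi : s.reg 3 = i) (hij : i + j = m)
    (h4 : ∀ v : Fin n, s.arr 4 v = 0 ↔ ∀ e : Fin m, e.val < i → G.tail σ e ≠ v)
    (H : ∀ s', Holds G r σ s' → (∀ v : Fin n, s'.arr 4 v = 0 ↔ G.IsSink σ v) →
      Attains o a T (k, s') g) :
    Attains o a (T + (12 * j + 1)) (.while (.lt 3 1) markBody :: k, s) g := by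
  induction j generalizing i s with
  | zero =>
    refine attains_while_false (by simp [Test.eval, hs.edges, hi]; omega) (H _ hs fun v => ?_)
    rw [h4, IsSink]
    exact forall_congr' fun e => ⟨fun h => h (by omega), fun h _ => h⟩
  | succ j ih =>
    have him : i < m := by omega
    obtain ⟨e, rfl⟩ : ∃ e : Fin m, e.val = i := ⟨⟨i, him⟩, rfl⟩
    refine Attains.mono (T := (T + (12 * j + 1)) + 11 + 1) ?_ (by omega)
    refine attains_while_true (by simp [Test.eval, hs.edges, hi]) ?_
    refine attains_seq (attains_load (attains_seq ?_))
    suffices hh : ∀ s' : Store, Holds G r σ s' → s'.arr = s.arr → s'.reg 3 = e →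
        s'.reg 5 = G.tail σ e →
        Attains o a (T + (12 * j + 1) + 5) ((block [.store 4 5 1, .inc 3]) ::
            .while (.lt 3 1) markBody :: k, s') g by
      have h3 := hs.orientation e
      by_cases hσ : σ e
      · refine attains_ite_false (by simp [Test.eval, Store.setReg, hs.zero, hi, h3, hσ]) ?_
        refine attains_load (Attains.mono (hh _ ?_ rfl ?_ ?_) (by omega))
        · constructor <;> simp [Store.setReg, hs.1, hs.2, hs.3, hs.4, hs.5, hs.6, hs.7]
        · simp [Store.setReg, hi]
        · simp [Store.setReg, hi, hs.fst, tail, hσ]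
      · refine attains_ite_true (by simp [Test.eval, Store.setReg, hs.zero, hi, h3, hσ]) ?_
        refine attains_load (Attains.mono (hh _ ?_ rfl ?_ ?_) (by omega))
        · constructor <;> simp [Store.setReg, hs.1, hs.2, hs.3, hs.4, hs.5, hs.6, hs.7]
        · simp [Store.setReg, hi]
        · simp [Store.setReg, hi, hs.snd, tail, hσ]
    clear hi
    intro s' hs' harr hi h5
    rw [← harr] at h4
    clear harr hs s
    refine attains_seq (attains_store (attains_seq (attains_inc (attains_skip ?_))))
    refine ih (i := e.val + 1) ?_ ?_ (by omega) ?_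
    · constructor <;> simp [Store.setReg, Store.setArr, hs'.1, hs'.2, hs'.3, hs'.4, hs'.5, hs'.6,
        hs'.7]
    · simp [Store.setReg, Store.setArr, hi]
    · intro v
      by_cases hv : v = G.tail σ e
      · subst hv
        simp only [Store.setReg, Store.setArr, h5, Function.update_self, hs'.edges]
        exact iff_of_false (by omega) fun h => h e (by omega) rfl
      · have : v.val ≠ (G.tail σ e).val := fun h' => hv (Fin.ext h')
        simp only [Store.setReg, Store.setArr, h5, Function.update_self,
          Function.update_of_ne this, h4]
        refine forall_congr' fun e' => ⟨fun h h' => ?_, fun h h' => h (by omega)⟩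
        by_cases he : e' = e
        · subst he; exact Ne.symm hv
        · have : e'.val ≠ e.val := fun h' => he (Fin.ext h')
          exact h (by omega)

theorem attains_round {r T : ℕ} {σ : G.Orientation} {s : Store} {k : List Program}
    {f : G.Orientation → ℝ} (hs : Holds G (r + 1) σ s)
    (H : ∀ ρ s', Holds G r ρ s' → Attains o a T (k, s') (f ρ)) :
    Attains o a (T + (32 * m + 6 * n + 30)) (round :: k, s) (G.popSinks f σ) := by
  classical
  have hres : ∀ s', Holds G r σ s' → (∀ v : Fin n, s'.arr 4 v = 0 ↔ G.IsSink σ v) →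
      Attains o a (T + (20 * m + 6)) (resample :: block [] :: k, s') (G.popSinks f σ) := by
    intro s' hs' h4
    have := attains_resample (o := o) (a := a) (T := T + 1) (k := block [] :: k) (f := f)
      (J := Finset.univ.filter fun v => G.IsSink σ v) hs' (by simpa using h4)
      (fun ρ s' h => attains_skip (H ρ s' h))
    simp only [Finset.mem_filter, Finset.mem_univ, true_and] at this
    refine Attains.mono ?_ (show T + 1 + (20 * m + 5) ≤ _ by omega)
    rw [popSinks, sinkEdges]
    convert this
  refine Attains.mono (T := (T + (20 * m + 12) + (12 * m + 1)) + 5 + (6 * n + 1) + 6) ?_ (by omega)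
  refine attains_seq (attains_dec (attains_seq (attains_seq (attains_const (attains_seq ?_)))))
  refine attains_while_unmark (r := r) (σ := σ) (i := 0) ?_ ?_ (by omega) (by simp) ?_
  · constructor <;> simp [Store.setReg, hs.1, hs.2, hs.3, hs.4, hs.5, hs.6, hs.7]
  · simp [Store.setReg]
  intro s' hs' h4
  refine attains_skip (attains_seq (attains_seq (attains_const (attains_seq ?_))))
  refine attains_while_mark (r := r) (σ := σ) (i := 0) ?_ ?_ (by omega) ?_ ?_
  · constructor <;> simp [Store.setReg, hs'.1, hs'.2, hs'.3, hs'.4, hs'.5, hs'.6, hs'.7]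
  · simp [Store.setReg]
  · simpa [Store.setReg] using h4
  intro s'' hs'' h4
  refine attains_skip (attains_seq (Attains.mono (hres _ hs'' h4) ?_))
  exact Nat.add_le_add_left (by omega) T

theorem attains_rounds {r T : ℕ} {σ : G.Orientation} {s : Store} {k : List Program}
    {f : G.Orientation → ℝ} (hs : Holds G r σ s)
    (H : ∀ ρ s', Holds G 0 ρ s' → Attains o a T (k, s') (f ρ)) :
    Attains o a (T + ((32 * m + 6 * n + 31) * r + 1)) (.while (.ne 6 2) round :: k, s)
      (G.popSinks^[r] f σ) := by
  induction r generalizing σ s with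
  | zero =>
    exact attains_while_false (by simp [Test.eval, hs.rounds, hs.zero]) (H _ _ hs)
  | succ r ih =>
    refine Attains.mono (T := (T + ((32 * m + 6 * n + 31) * r + 1)) + (32 * m + 6 * n + 30) + 1)
      ?_ (by linarith)
    refine attains_while_true (by simp [Test.eval, hs.rounds, hs.zero]) ?_
    -- The outermost `popSinks` is the round executed first; the inner iterate is the bound after
    -- it.
    rw [Function.iterate_succ_apply']
    exact attains_round hs fun ρ s' h => ih h

end SinkPopping

/-! ### Computing the number of rounds, and the whole program. -/

namespace SinkPopping

open RAM EdgeListGraph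

variable {n m : ℕ} {G : EdgeListGraph n m} {α : Type*} {o : Config → α} {a : α}

theorem attains_addThree {T : ℕ} {s : Store} {k : List Program} {g : ℝ}
    (H : Attains o a T (k, s.setReg 6 (s.reg 6 + 3)) g) :
    Attains o a (T + 7) (addThree :: k, s) g := by
  refine attains_seq (attains_inc (attains_seq (attains_inc (attains_seq (attains_inc
    (attains_skip ?_))))))
  simpa [Store.setReg] using H

theorem attains_while_double {z T : ℕ} {s : Store} {k : List Program} {g : ℝ}
    (h2 : s.reg 2 = 0) (h8 : s.reg 8 = z)
    (H : ∀ s', s'.arr = s.arr → s'.reg 7 = s.reg 7 + z →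
      (∀ x < 7, s'.reg x = s.reg x) → Attains o a T (k, s') g) :
    Attains o a (T + (6 * z + 1)) (.while (.ne 8 2) doubleBody :: k, s) g := by
  induction z generalizing s with
  | zero =>
    exact attains_while_false (by simp [Test.eval, h2, h8]) (H _ rfl rfl fun _ _ => rfl)
  | succ z ih =>
    refine Attains.mono (T := (T + (6 * z + 1)) + 5 + 1) ?_ (by omega)
    refine attains_while_true (by simp [Test.eval, h2, h8]) ?_
    refine attains_seq (attains_inc (attains_seq (attains_dec (attains_skip ?_))))
    refine ih (by simp [Store.setReg, h2]) (by simp [Store.setReg, h8])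
      fun s' h h7 hx => H s' h ?_ fun x hlt => ?_
    · rw [h7]
      simp [Store.setReg]
      omega
    · rw [hx x hlt]
      have h7 : x ≠ 7 := by omega
      have h8 : x ≠ 8 := by omega
      simp [Store.setReg, h7, h8]

theorem attains_while_countVertices {r i j T : ℕ} {σ : G.Orientation} {s : Store}
    {k : List Program} {g : ℝ} (hs : Holds G r σ s) (h7 : s.reg 7 = 2 ^ i)
    (hij : i + j = Nat.clog 2 n)
    (H : ∀ s', Holds G (r + 3 * j) σ s' → s'.arr = s.arr → s'.reg 3 = s.reg 3 →
      Attains o a T (k, s') g) :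
    Attains o a (T + ((6 * n + 14) * j + 1)) (.while (.lt 7 0)
      (block [.copy 8 7, .while (.ne 8 2) doubleBody, addThree]) :: k, s) g := by
  induction j generalizing r i s with
  | zero =>
    refine attains_while_false ?_ (H _ hs rfl rfl)
    simpa [Test.eval, hs.vertices, h7] using (Nat.clog_le_iff_le_pow (by norm_num)).1 hij.ge
  | succ j ih =>
    have hlt : 2 ^ i < n := (Nat.lt_clog_iff_pow_lt (by norm_num)).1 (by omega)
    -- Each doubling is charged as if `2 ^ i` were `n`; this is crude, but O(n log n) is affordable.
    refine Attains.mono (T := ((T + ((6 * n + 14) * j + 1)) + 9 + (6 * 2 ^ i + 1)) + 3 + 1)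
      ?_ (by linarith)
    refine attains_while_true (by simpa [Test.eval, hs.vertices, h7] using hlt) ?_
    refine attains_seq (attains_copy (attains_seq ?_))
    refine attains_while_double (by simp [Store.setReg, hs.zero]) (by simp [Store.setReg, h7])
      fun s' harr h7' hx => ?_
    refine attains_seq (attains_addThree (attains_skip ?_))
    have hx' : ∀ x < 7, s'.reg x = s.reg x := fun x hlt => by
      rw [hx x hlt]
      have h8 : x ≠ 8 := by omega
      simp [Store.setReg, h8]
    refine ih (r := r + 3) (i := i + 1) ?_ ?_ (by omega) ?_
    · constructor <;> simp [Store.setReg, hx', harr, hs.1, hs.2, hs.3, hs.4, hs.5, hs.6, hs.7]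
    · rw [pow_succ]
      simp only [Store.setReg] at h7' ⊢
      simp [h7', h7]
      omega
    · intro s'' h₁ h₂ h₃
      refine H s'' (by convert h₁ using 1; ring) (by simp [h₂, Store.setReg, harr]) ?_
      simp [h₃, Store.setReg, hx']

theorem attains_while_countDigits {r i j D T : ℕ} {σ : G.Orientation} {s : Store}
    {k : List Program} {g : ℝ} (hs : Holds G r σ s) (h3 : s.reg 3 = i) (h4 : s.reg 4 = s.arr 2 i)
    (hij : i + j = D) (hD : ∀ i < D, s.arr 2 i = 0) (hD' : s.arr 2 D ≠ 0)
    (H : ∀ s', Holds G (r + 3 * j) σ s' → s'.arr = s.arr → Attains o a T (k, s') g) :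
    Attains o a (T + (14 * j + 1))
      (.while (.eq 4 2) (block [.inc 3, addThree, .load 4 2 3]) :: k, s) g := by
  induction j generalizing r i s with
  | zero =>
    obtain rfl : i = D := hij
    exact attains_while_false (by simp [Test.eval, hs.zero, h4, hD']) (H _ hs rfl)
  | succ j ih =>
    refine Attains.mono (T := ((T + (14 * j + 1)) + 3 + 7) + 3 + 1) ?_ (by omega)
    refine attains_while_true (by simp [Test.eval, hs.zero, h4, hD i (by omega)]) ?_
    refine attains_seq (attains_inc (attains_seq ?_))
    refine attains_addThree (attains_seq (attains_load (attains_skip ?_)))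
    refine ih (r := r + 3) (i := i + 1) ?_ ?_ ?_ (by omega) (by simpa [Store.setReg] using hD)
      (by simpa [Store.setReg] using hD') ?_
    · constructor <;> simp [Store.setReg, hs.1, hs.2, hs.3, hs.4, hs.5, hs.6, hs.7]
    · simp [Store.setReg, h3]
    · simp [Store.setReg, h3]
    · intro s' h₁ h₂
      exact H s' (by convert h₁ using 1; ring) (by simp [h₂, Store.setReg])

theorem attains_program {ε : ℝ} {D : ℕ} (hD : ∀ i < D, Real.digits ε 2 i = 0)
    (hD' : Real.digits ε 2 D ≠ 0) {f : G.Orientation → ℝ}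
    (H : ∀ ρ s', Holds G 0 ρ s' → Attains o a 0 ([], s') (f ρ)) :
    Attains o a ((32 * m + 6 * n + 31) * (3 * (Nat.clog 2 n + D + 1)) +
        (6 * n + 14) * Nat.clog 2 n + 14 * D + 20 * m + 50) ([program], G.input ε)
      ((∑ ρ, G.popSinks^[3 * (Nat.clog 2 n + D + 1)] f ρ) / 2 ^ m) := by
  obtain ⟨r, hr⟩ : ∃ r, r = 3 * (Nat.clog 2 n + D + 1) := ⟨_, rfl⟩
  obtain ⟨R, hR⟩ : ∃ R, R = (32 * m + 6 * n + 31) * r + 1 := ⟨_, rfl⟩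
  rw [← hr]
  have h₀ : Holds G 0 (fun _ => false) (G.input ε) := by
    constructor <;> simp [input]
  have hlast : ∀ s', Holds G r (fun _ => false) s' → (∀ v, s'.arr 4 v = 0) →
      Attains o a (R + 2 + (20 * m + 5)) (resample :: block [.while (.ne 6 2) round] :: [], s')
        ((∑ ρ, G.popSinks^[r] f ρ) / 2 ^ m) := by
    intro s' hs' h4
    -- No vertex is marked yet, so every edge is tossed and the loop draws the uniform initial
    -- orientation.
    have := attains_resample (o := o) (a := a) (T := R + 2)
      (k := [block [.while (.ne 6 2) round]]) (f := G.popSinks^[r] f)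
      (J := Finset.univ) hs' (by simp [h4]) fun ρ s'' h => by
        refine attains_seq ?_
        have := attains_rounds (T := 1) (k := [block []]) (f := f) h fun ρ s' h' =>
          attains_skip (H ρ s' h')
        exact this.mono (by omega)
    simpa [average_univ] using this
  refine Attains.mono (T := (R + 2 + (20 * m + 5) + 10 + 3 + (14 * D + 1)) + 5 +
    ((6 * n + 14) * Nat.clog 2 n + 1) + 4) ?_ (by omega)
  refine attains_seq (attains_seq (attains_const (attains_seq ?_)))
  refine attains_while_countVertices (G := G) (r := 0) (i := 0) (σ := fun _ => false)
    ?_ (by simp [Store.setReg]) (by omega) ?_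
  · constructor <;> simp [Store.setReg, h₀.1, h₀.2, h₀.3, h₀.4, h₀.5, h₀.6, h₀.7]
  intro s₁ hs₁ harr₁ h3
  -- `countDigits` does not initialise its index, register `3`, so the zero of the input must have
  -- survived.
  have h3 : s₁.reg 3 = 0 := by rw [h3]; simp [Store.setReg, input]
  have h2 : ∀ i, s₁.arr 2 i = (Real.digits ε 2 i : ℕ) := by
    rw [harr₁]; intro i; simp [Store.setReg, input]
  refine attains_skip (attains_seq (attains_seq (attains_load ?_)))
  refine attains_seq ?_
  refine attains_while_countDigits (G := G) (i := 0) (D := D) (σ := fun _ => false)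
    (r := 3 * Nat.clog 2 n) (j := D) ?_ ?_ ?_ (by omega) ?_ ?_ ?_
  · constructor <;> simp [Store.setReg, hs₁.1, hs₁.2, hs₁.3, hs₁.4, hs₁.5, hs₁.6, hs₁.7]
  · simp [Store.setReg, h3]
  · simp [Store.setReg, h3]
  · simp +contextual [Store.setReg, h2, hD]
  · simpa [Store.setReg, h2] using hD'
  intro s₂ hs₂ harr₂
  refine attains_skip (attains_seq (attains_addThree (attains_seq ?_)))
  refine Attains.mono (hlast _ ?_ ?_) (Nat.le_add_right _ 3)
  · constructor <;> simp [Store.setReg, hs₂.1, hs₂.2, hs₂.3, hs₂.4, hs₂.5, hs₂.6, hs₂.7, hr]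
    ring
  · intro v
    simp [Store.setReg, harr₂, harr₁, input]

end SinkPopping

/-! ## Counting orientations without prescribed sinks -/

namespace EdgeListGraph

variable {n m : ℕ} (G : EdgeListGraph n m)

/-- The neighbours of a vertex; a vertex with a loop is its own neighbour. -/
def neighbors (v : Fin n) : Finset (Fin n) :=
  (Finset.univ.filter fun e => G.fst e = v).image G.snd ∪
    (Finset.univ.filter fun e => G.snd e = v).image G.fst

/-- The edges that have an endpoint in `J`. -/
def edgesAt (J : Finset (Fin n)) : Finset (Fin m) :=
  Finset.univ.filter fun e => G.fst e ∈ J ∨ G.snd e ∈ J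

/-- The vertices of `J` and their neighbours. -/
def closedNeighbors (J : Finset (Fin n)) : Finset (Fin n) := J ∪ J.biUnion G.neighbors

open Classical in
/-- The set of sinks of an orientation. -/
noncomputable def sinks (σ : G.Orientation) : Finset (Fin n) :=
  Finset.univ.filter fun v => G.IsSink σ v

open Classical in
/-- The orientations in which no vertex of `S` is a sink. -/
noncomputable def sinkFreeOn (S : Finset (Fin n)) : Finset G.Orientation :=
  Finset.univ.filter fun σ => ∀ v ∈ S, ¬ G.IsSink σ v

open Classical in
/-- The orientations in which no vertex of `S` is a sink, but `v` is one. -/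
noncomputable def sinkFreeOnWithSink (S : Finset (Fin n)) (v : Fin n) : Finset G.Orientation :=
  (G.sinkFreeOn S).filter fun σ => G.IsSink σ v

variable {G}

theorem mem_neighbors {u v : Fin n} : u ∈ G.neighbors v ↔
    ∃ e, (G.fst e = v ∧ G.snd e = u) ∨ (G.snd e = v ∧ G.fst e = u) := by
  simp only [neighbors, Finset.mem_union, Finset.mem_image, Finset.mem_filter, Finset.mem_univ,
    true_and, exists_or]

theorem mem_edgesAt {J : Finset (Fin n)} {e : Fin m} :
    e ∈ G.edgesAt J ↔ G.fst e ∈ J ∨ G.snd e ∈ J := by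
  simp [edgesAt]

theorem mem_sinks {σ : G.Orientation} {v : Fin n} : v ∈ G.sinks σ ↔ G.IsSink σ v := by
  simp [sinks]

theorem mem_sinkFreeOn {S : Finset (Fin n)} {σ : G.Orientation} :
    σ ∈ G.sinkFreeOn S ↔ ∀ v ∈ S, ¬ G.IsSink σ v := by
  simp [sinkFreeOn]

theorem mem_sinkFreeOnWithSink {S : Finset (Fin n)} {v : Fin n} {σ : G.Orientation} :
    σ ∈ G.sinkFreeOnWithSink S v ↔ (∀ v ∈ S, ¬ G.IsSink σ v) ∧ G.IsSink σ v := by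
  simp [sinkFreeOnWithSink, mem_sinkFreeOn]

theorem neighbors_symm {u v : Fin n} (h : u ∈ G.neighbors v) : v ∈ G.neighbors u := by
  obtain ⟨e, he⟩ := mem_neighbors.1 h
  exact mem_neighbors.2 ⟨e, by tauto⟩

theorem card_neighbors_le (v : Fin n) : (G.neighbors v).card ≤ G.degree v :=
  (Finset.card_union_le _ _).trans (add_le_add Finset.card_image_le Finset.card_image_le)

theorem tail_congr {σ ρ : G.Orientation} {e : Fin m} (h : σ e = ρ e) :
    G.tail σ e = G.tail ρ e := by
  rw [tail, tail, h]

/-- The tail of an edge with an endpoint in `J` is in `J` or a neighbour of `J`. -/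
theorem tail_mem_closedNeighbors {J : Finset (Fin n)} {σ : G.Orientation} {e : Fin m}
    (he : e ∈ G.edgesAt J) : G.tail σ e ∈ G.closedNeighbors J := by
  rw [closedNeighbors, Finset.mem_union, Finset.mem_biUnion]
  by_cases hσ : σ e
  · rw [tail, if_pos hσ]
    exact (mem_edgesAt.1 he).imp id fun h => ⟨_, h, mem_neighbors.2 ⟨e, Or.inr ⟨rfl, rfl⟩⟩⟩
  · rw [tail, if_neg hσ]
    exact (mem_edgesAt.1 he).symm.imp id fun h => ⟨_, h, mem_neighbors.2 ⟨e, Or.inl ⟨rfl, rfl⟩⟩⟩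

theorem mem_edgesAt_of_tail_mem {J : Finset (Fin n)} {σ : G.Orientation} {e : Fin m}
    (h : G.tail σ e ∈ J) : e ∈ G.edgesAt J := by
  rw [mem_edgesAt]
  by_cases hσ : σ e
  · rw [tail, if_pos hσ] at h; exact Or.inl h
  · rw [tail, if_neg hσ] at h; exact Or.inr h

/-- Two orientations with the same sink `v` agree on the edges at `v`. -/
theorem IsSink.eq_of_mem {σ ρ : G.Orientation} {v : Fin n} (hσ : G.IsSink σ v)
    (hρ : G.IsSink ρ v) {e : Fin m} (he : e ∈ G.edgesAt {v}) : σ e = ρ e := by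
  have h₁ := hσ e
  have h₂ := hρ e
  rw [mem_edgesAt, Finset.mem_singleton, Finset.mem_singleton] at he
  unfold tail at h₁ h₂
  cases h : σ e <;> cases h' : ρ e <;> simp_all

/-- A loop would leave its vertex, so there is none at a sink and the degree counts every incident
edge once. -/
theorem card_edgesAt_of_isSink {σ : G.Orientation} {v : Fin n} (hσ : G.IsSink σ v) :
    (G.edgesAt {v}).card = G.degree v := by
  rw [degree, ← Finset.card_union_of_disjoint, ← Finset.filter_or]
  · simp [edgesAt]
  · rw [Finset.disjoint_filter]
    intro e _ h₁ h₂
    refine hσ e ?_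
    rw [tail, h₁, h₂, ite_self]

/-! ### A local-lemma bound for the probability of a sink. -/

/-- Reverse an arbitrary set of edges at the sink `v`. This can create sinks only at `v` and its
neighbours, and it can be undone because all edges at `v` were directed towards `v`. -/
theorem two_pow_mul_card_le {S : Finset (Fin n)} {v : Fin n} (hv : v ∉ S) :
    2 ^ G.degree v * (G.sinkFreeOnWithSink S v).card ≤
      (G.sinkFreeOn (S \ G.neighbors v)).card := by
  rcases (G.sinkFreeOnWithSink S v).eq_empty_or_nonempty with h | ⟨σ₀, hσ₀⟩
  · simp [h]
  rw [← card_edgesAt_of_isSink (mem_sinkFreeOnWithSink.1 hσ₀).2, ← Finset.card_powerset,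
    ← Finset.card_product]
  refine Finset.card_le_card_of_injOn
    (fun p e => if e ∈ p.1 then !p.2 e else p.2 e) ?_ ?_
  · rintro ⟨A, σ⟩ h
    obtain ⟨hA, hσ⟩ := Finset.mem_product.1 (Finset.mem_coe.1 h)
    rw [Finset.mem_powerset] at hA
    obtain ⟨hS, -⟩ := mem_sinkFreeOnWithSink.1 hσ
    refine Finset.mem_coe.2 (mem_sinkFreeOn.2 fun u hu hsink => ?_)
    obtain ⟨huS, huv⟩ := Finset.mem_sdiff.1 hu
    refine hS u huS fun e he => ?_
    have heA : e ∉ A := fun heA => by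
      have := tail_mem_closedNeighbors (σ := σ) (hA heA)
      simp only [he, closedNeighbors, Finset.mem_union, Finset.mem_singleton,
        Finset.singleton_biUnion] at this
      rcases this with rfl | h
      · exact hv huS
      · exact huv h
    refine hsink e ?_
    rw [← he]
    exact tail_congr (by simp [heA])
  · rintro ⟨A, σ⟩ h ⟨B, ρ⟩ h' heq
    obtain ⟨hA, hσ⟩ := Finset.mem_product.1 (Finset.mem_coe.1 h)
    obtain ⟨hB, hρ⟩ := Finset.mem_product.1 (Finset.mem_coe.1 h')
    rw [Finset.mem_powerset] at hA hB
    have hσv := (mem_sinkFreeOnWithSink.1 hσ).2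
    have hρv := (mem_sinkFreeOnWithSink.1 hρ).2
    have key : ∀ e, (e ∈ A ↔ e ∈ B) ∧ σ e = ρ e := fun e => by
      have he := congrFun heq e
      simp only at he
      by_cases h : e ∈ G.edgesAt {v}
      · have hh := hσv.eq_of_mem hρv h
        refine ⟨?_, hh⟩
        change σ e = ρ e at hh
        rw [hh] at he
        by_cases e ∈ A <;> by_cases e ∈ B <;> simp_all
      · have h₁ : e ∉ A := fun h' => h (hA h')
        have h₂ : e ∉ B := fun h' => h (hB h')
        simp_all
    exact Prod.ext (Finset.ext fun e => (key e).1) (funext fun e => (key e).2)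

theorem card_sinkFreeOn_insert (S : Finset (Fin n)) (v : Fin n) :
    (G.sinkFreeOn (insert v S)).card + (G.sinkFreeOnWithSink S v).card =
      (G.sinkFreeOn S).card := by
  classical
  rw [← Finset.card_filter_add_card_filter_not (s := G.sinkFreeOn S) (fun σ => ¬ G.IsSink σ v)]
  congr 2
  · ext σ
    simp [mem_sinkFreeOn, and_comm]
  · ext σ
    simp [mem_sinkFreeOnWithSink, mem_sinkFreeOn]

/-- The gain from one neighbour lying outside the set: with k ≤ d - 1 the factor (4/5)^k 2^d is at
least 2 (8/5)^(d-1). -/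
theorem two_mul_pow_mul_le {x c : ℝ} {d k : ℕ} (hx : 0 ≤ x) (hd : 3 ≤ d) (hk : k + 1 ≤ d)
    (h : (4 / 5 : ℝ) ^ k * 2 ^ d * x ≤ c) : 2 * (8 / 5 : ℝ) ^ (d - 1) * x ≤ c := by
  refine le_trans (mul_le_mul_of_nonneg_right ?_ hx) h
  obtain ⟨d, rfl⟩ := Nat.exists_eq_add_of_le' (show 1 ≤ d by omega)
  rw [Nat.add_sub_cancel]
  calc 2 * (8 / 5 : ℝ) ^ d = (4 / 5 : ℝ) ^ d * 2 ^ (d + 1) := by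
        rw [pow_succ, ← mul_assoc, ← mul_pow]; norm_num; ring
    _ ≤ _ := by
        gcongr 1
        exact pow_le_pow_of_le_one (by norm_num) (by norm_num) (by omega)

/-- The reversal injection applies once the conditions at neighbours of `v` are dropped. These are
restored one vertex at a time, and by induction each keeps at least 4/5 of the orientations. -/
theorem pow_mul_card_le (hG : ∀ v, 3 ≤ G.degree v) (S : Finset (Fin n)) {v : Fin n} (hv : v ∉ S) :
    (4 / 5 : ℝ) ^ (S ∩ G.neighbors v).card * 2 ^ G.degree v * (G.sinkFreeOnWithSink S v).card ≤
      (G.sinkFreeOn S).card := by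
  induction S using Finset.strongInduction generalizing v with
  | H S ih =>
    have key : ∀ U ⊆ S ∩ G.neighbors v,
        (4 / 5 : ℝ) ^ U.card * (G.sinkFreeOn (S \ G.neighbors v)).card ≤
          (G.sinkFreeOn (S \ G.neighbors v ∪ U)).card := by
      intro U
      induction U using Finset.induction_on with
      | empty => simp
      | insert u U hu ihU =>
        intro hU
        rw [Finset.insert_subset_iff] at hU
        obtain ⟨huS, huv⟩ := Finset.mem_inter.1 hU.1
        have hsub : S \ G.neighbors v ∪ U ⊆ S :=
          Finset.union_subset Finset.sdiff_subset (hU.2.trans Finset.inter_subset_left)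
        have huT : u ∉ S \ G.neighbors v ∪ U := by simp [hu, huv]
        have h₁ := ih _ (Finset.ssubset_iff_subset_ne.2 ⟨hsub, fun h => huT (h.symm.subset huS)⟩) huT
        have hcard : ((S \ G.neighbors v ∪ U) ∩ G.neighbors u).card + 1 ≤ G.degree u := by
          -- `v` is a neighbour of `u` outside the current set, so at most d - 1 neighbours of `u`
          -- are inside, where d is the degree of `u`.
          have hvT : v ∉ (S \ G.neighbors v ∪ U) ∩ G.neighbors u := fun h =>
            hv (hsub (Finset.mem_inter.1 h).1)
          rw [← Finset.card_insert_of_notMem hvT]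
          refine (Finset.card_le_card ?_).trans (card_neighbors_le u)
          exact Finset.insert_subset (neighbors_symm huv) Finset.inter_subset_right
        have h₂ := two_mul_pow_mul_le (Nat.cast_nonneg _) (hG u) hcard h₁
        -- Since 2 (8/5)^2 = 5.12, the vertex `u` is a sink with probability at most 1/5.
        have h₃ : (5 : ℝ) ≤ 2 * (8 / 5 : ℝ) ^ (G.degree u - 1) := by
          have : (8 / 5 : ℝ) ^ 2 ≤ (8 / 5 : ℝ) ^ (G.degree u - 1) :=
            pow_le_pow_right₀ (by norm_num) (by have := hG u; omega)
          linarith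
        have h₄ := mul_le_mul_of_nonneg_right h₃
          (Nat.cast_nonneg (α := ℝ) (G.sinkFreeOnWithSink (S \ G.neighbors v ∪ U) u).card)
        have h₅ := card_sinkFreeOn_insert (G := G) (S \ G.neighbors v ∪ U) u
        rw [← @Nat.cast_inj ℝ] at h₅
        push_cast at h₅
        rw [Finset.card_insert_of_notMem hu, pow_succ, Finset.union_insert]
        have h₆ := ihU hU.2
        linarith
    have h := key _ subset_rfl
    rw [Finset.sdiff_union_inter] at h
    refine le_trans ?_ h
    rw [mul_assoc]
    gcongr
    exact_mod_cast two_pow_mul_card_le hv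

/-- `S` is open-ended if every vertex outside `S` has a neighbour outside `S`. -/
def OpenEnded (G : EdgeListGraph n m) (S : Finset (Fin n)) : Prop :=
  ∀ v ∉ S, ∃ w ∈ G.neighbors v, w ∉ S

theorem succ_degree_mul_card_le (hG : ∀ v, 3 ≤ G.degree v) {S : Finset (Fin n)}
    (hS : G.OpenEnded S) {v : Fin n} (hv : v ∉ S) :
    ((G.degree v : ℝ) + 1) * (G.sinkFreeOnWithSink S v).card ≤
      25 / 32 * (G.sinkFreeOn S).card := by
  obtain ⟨w, hw, hwS⟩ := hS v hv
  have hcard : (S ∩ G.neighbors v).card + 1 ≤ G.degree v := by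
    rw [← Finset.card_insert_of_notMem (a := w) (by simp [hwS])]
    refine (Finset.card_le_card ?_).trans (card_neighbors_le v)
    exact Finset.insert_subset hw Finset.inter_subset_right
  have h := two_mul_pow_mul_le (Nat.cast_nonneg _) (hG v) hcard (pow_mul_card_le hG S hv)
  -- Here the degree is `d + 3`. The constant makes degree three an equality, and this is where
  -- 25/32 comes from.
  have hd : ∀ d : ℕ, ((d : ℝ) + 4) ≤ 25 / 16 * (8 / 5 : ℝ) ^ (d + 2) := by
    intro d
    induction d with
    | zero => norm_num
    | succ d ih =>
      rw [Nat.add_right_comm, pow_succ]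
      push_cast
      have : (0 : ℝ) ≤ d := Nat.cast_nonneg d
      linarith
  obtain ⟨d, hd'⟩ := Nat.exists_eq_add_of_le' (hG v)
  have h' := hd d
  rw [hd'] at h ⊢
  rw [show d + 3 - 1 = d + 2 by omega] at h
  have hx : (0 : ℝ) ≤ (G.sinkFreeOnWithSink S v).card := Nat.cast_nonneg _
  push_cast
  nlinarith [mul_le_mul_of_nonneg_right h' hx]

theorem sinkFreeOn_univ : G.sinkFreeOn Finset.univ = G.sinkFree := by
  ext σ
  simp [sinkFreeOn, sinkFree]

/-- Open-endedness is not needed here: even with all neighbours in `S`, (8/5)^d > 1 shows that not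
every orientation counted so far has a sink at the new vertex. -/
theorem sinkFreeOn_nonempty (hG : ∀ v, 3 ≤ G.degree v) (S : Finset (Fin n)) :
    (G.sinkFreeOn S).Nonempty := by
  induction S using Finset.induction_on with
  | empty => exact ⟨fun _ => true, by simp [mem_sinkFreeOn]⟩
  | insert v S hv ih =>
    have h := pow_mul_card_le hG S hv
    have h₁ : (1 : ℝ) < (4 / 5 : ℝ) ^ (S ∩ G.neighbors v).card * 2 ^ G.degree v := by
      calc (1 : ℝ) < (8 / 5 : ℝ) ^ G.degree v :=
            one_lt_pow₀ (by norm_num) (by have := hG v; omega)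
        _ = (4 / 5 : ℝ) ^ G.degree v * 2 ^ G.degree v := by rw [← mul_pow]; norm_num
        _ ≤ _ := by
          gcongr 1
          refine pow_le_pow_of_le_one (by norm_num) (by norm_num) ?_
          exact (Finset.card_le_card Finset.inter_subset_right).trans (card_neighbors_le v)
    have h₂ := card_sinkFreeOn_insert (G := G) S v
    have h₃ := ih.card_pos
    rw [← Finset.card_pos]
    by_contra h₀
    have h₄ : (G.sinkFreeOnWithSink S v).card = (G.sinkFreeOn S).card := by omega
    rw [h₄] at h
    have : (0 : ℝ) < (G.sinkFreeOn S).card := by exact_mod_cast h₃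
    nlinarith

/-! ## One round of sink popping -/

/-- The tail of an edge is never a sink, so a sink at either end must be its head. -/
theorem sinkEdges_eq (σ : G.Orientation) : G.sinkEdges σ = G.edgesAt (G.sinks σ) := by
  ext e
  have h : G.IsSink σ (G.head σ e) ↔ G.IsSink σ (G.fst e) ∨ G.IsSink σ (G.snd e) := by
    have ht : ¬ G.IsSink σ (G.tail σ e) := fun h => h e rfl
    unfold head
    unfold tail at ht
    cases h : σ e <;> simp_all
  simp [sinkEdges, mem_edgesAt, mem_sinks, h]

theorem mix_mix (D : Finset (Fin m)) (σ ρ : Fin m → Bool) :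
    mix D (mix D σ ρ) (mix D ρ σ) = σ := by
  ext e
  by_cases h : e ∈ D <;> simp [mix, h]

theorem mix_mem_sinkFreeOn {J : Finset (Fin n)} {σ ρ : G.Orientation} (hσ : G.sinks σ = J) :
    mix (G.edgesAt J) σ ρ ∈ G.sinkFreeOn (G.closedNeighbors J)ᶜ := by
  rw [mem_sinkFreeOn]
  intro u hu hsink
  rw [Finset.mem_compl] at hu
  have huJ : u ∉ J := fun h => hu (Finset.mem_union_left _ h)
  rw [← hσ, mem_sinks] at huJ
  refine huJ fun e he => hsink e ?_
  have heJ : e ∉ G.edgesAt J := fun h => hu (he ▸ tail_mem_closedNeighbors h)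
  rw [← he]
  exact tail_congr (by simp [mix, heJ])

theorem subset_sinks_mix {J : Finset (Fin n)} {σ ρ : G.Orientation} (hσ : J ⊆ G.sinks σ) :
    J ⊆ G.sinks (mix (G.edgesAt J) ρ σ : G.Orientation) := by
  intro v hv
  rw [mem_sinks]
  intro e he
  have heJ : e ∈ G.edgesAt J := mem_edgesAt_of_tail_mem (he ▸ hv)
  refine mem_sinks.1 (hσ hv) e ?_
  rw [← he]
  exact tail_congr (by simp [mix, heJ])

/-- Edges at `J` are taken from `ρ`, where they enter `J`; hence they leave the other neighbours of
`J`, which cannot be sinks. Beyond the neighbourhood, `σ` supplies the outgoing edges. -/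
theorem sinks_mix {J : Finset (Fin n)} {σ ρ : G.Orientation}
    (hσ : σ ∈ G.sinkFreeOn (G.closedNeighbors J)ᶜ) (hρ : J ⊆ G.sinks ρ) :
    G.sinks (mix (G.edgesAt J) σ ρ : G.Orientation) = J := by
  refine subset_antisymm (fun u hu => ?_) (subset_sinks_mix hρ)
  by_contra huJ
  rw [mem_sinks] at hu
  by_cases hN : u ∈ G.closedNeighbors J
  · rw [closedNeighbors, Finset.mem_union, Finset.mem_biUnion] at hN
    obtain ⟨v, hv, huv⟩ := hN.resolve_left huJ
    obtain ⟨e, he⟩ := mem_neighbors.1 huv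
    have heJ : e ∈ G.edgesAt J := by
      rw [mem_edgesAt]
      rcases he with ⟨rfl, -⟩ | ⟨rfl, -⟩
      · exact Or.inl hv
      · exact Or.inr hv
    have h₁ := hu e
    have h₂ := mem_sinks.1 (hρ hv) e
    rw [tail_congr (show mix (G.edgesAt J) σ ρ e = ρ e by simp [mix, heJ])] at h₁
    unfold tail at h₁ h₂
    cases h : ρ e <;> rcases he with ⟨rfl, rfl⟩ | ⟨rfl, rfl⟩ <;> simp_all
  · refine mem_sinkFreeOn.1 hσ u (Finset.mem_compl.2 hN) fun e he => hu e ?_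
    have heJ : e ∉ G.edgesAt J := fun h => hN (he ▸ tail_mem_closedNeighbors h)
    rw [← he]
    exact tail_congr (by simp [mix, heJ])

/-- Exchanging `σ` and `ρ` on the edges at `J` is an involution of pairs. It trades "sinks exactly
`J`, second entry arbitrary" for "no sinks outside the closed neighbourhood, `J` among the sinks of
the second entry". -/
theorem sum_sum_mix (J : Finset (Fin n)) (f : G.Orientation → ℝ) :
    ∑ σ with G.sinks σ = J, ∑ ρ, f (mix (G.edgesAt J) σ ρ) =
      (Finset.univ.filter fun ρ : G.Orientation => J ⊆ G.sinks ρ).card *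
        ∑ ρ ∈ G.sinkFreeOn (G.closedNeighbors J)ᶜ, f ρ := by
  have h : (Finset.univ.filter fun ρ : G.Orientation => J ⊆ G.sinks ρ).card *
        ∑ ρ ∈ G.sinkFreeOn (G.closedNeighbors J)ᶜ, f ρ =
      ∑ ρ ∈ G.sinkFreeOn (G.closedNeighbors J)ᶜ,
        ∑ _σ with J ⊆ G.sinks _σ, f ρ := by
    simp [Finset.mul_sum]
  rw [h, ← Finset.sum_product', ← Finset.sum_product']
  refine Finset.sum_bij' (fun p _ => (mix (G.edgesAt J) p.1 p.2, mix (G.edgesAt J) p.2 p.1))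
    (fun p _ => (mix (G.edgesAt J) p.1 p.2, mix (G.edgesAt J) p.2 p.1)) ?_ ?_ ?_ ?_ ?_
  · rintro ⟨σ, ρ⟩ hp
    simp only [Finset.mem_product, Finset.mem_filter, Finset.mem_univ, true_and, and_true] at hp ⊢
    exact ⟨mix_mem_sinkFreeOn hp, subset_sinks_mix hp.ge⟩
  · rintro ⟨σ, ρ⟩ hp
    simp only [Finset.mem_product, Finset.mem_filter, Finset.mem_univ, true_and, and_true] at hp ⊢
    exact sinks_mix hp.1 hp.2
  · rintro ⟨σ, ρ⟩ _
    exact Prod.ext (mix_mix _ _ _) (mix_mix _ _ _)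
  · rintro ⟨σ, ρ⟩ _
    exact Prod.ext (mix_mix _ _ _) (mix_mix _ _ _)
  · rintro ⟨σ, ρ⟩ _
    rfl

/-- Given that `J` is the set of sinks, one round yields the uniform distribution on the
orientations without sinks at distance more than one from `J`. -/
theorem sum_popSinks_mul_card (J : Finset (Fin n)) (f : G.Orientation → ℝ) :
    (∑ σ with G.sinks σ = J, G.popSinks f σ) * (G.sinkFreeOn (G.closedNeighbors J)ᶜ).card =
      (Finset.univ.filter fun σ : G.Orientation => G.sinks σ = J).card *
        ∑ ρ ∈ G.sinkFreeOn (G.closedNeighbors J)ᶜ, f ρ := by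
  have h₁ := sum_sum_mix J f
  -- The constant function yields the normalising factor.
  have h₂ := sum_sum_mix (G := G) J fun _ => 1
  simp only [Finset.sum_const, Finset.card_univ, nsmul_eq_mul, mul_one, Fintype.card_pi,
    Fintype.card_bool, Finset.prod_const, Fintype.card_fin] at h₂
  have h₃ : ∑ σ with G.sinks σ = J, G.popSinks f σ =
      (∑ σ with G.sinks σ = J, ∑ ρ, f (mix (G.edgesAt J) σ ρ)) / 2 ^ m := by
    rw [Finset.sum_div]
    refine Finset.sum_congr rfl fun σ hσ => ?_
    rw [popSinks, average, sinkEdges_eq, (Finset.mem_filter.1 hσ).2]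
  rw [h₃, h₁]
  push_cast at h₂
  field_simp
  linear_combination -(∑ ρ ∈ G.sinkFreeOn (G.closedNeighbors J)ᶜ, f ρ) * h₂

/-- A vertex of `J` has an edge, whose other end is in the closed neighbourhood; a neighbour of `J`
has a neighbour in `J`. -/
theorem openEnded_compl_closedNeighbors (hG : ∀ v, 3 ≤ G.degree v) (J : Finset (Fin n)) :
    G.OpenEnded (G.closedNeighbors J)ᶜ := by
  intro v hv
  simp only [Finset.mem_compl, not_not, closedNeighbors, Finset.mem_union,
    Finset.mem_biUnion] at hv ⊢
  rcases hv with hv | ⟨w, hw, hvw⟩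
  · obtain ⟨e, he⟩ : ∃ e, G.fst e = v ∨ G.snd e = v := by
      by_contra! h
      have := hG v
      simp [degree, h] at this
    rcases he with rfl | rfl
    · have : G.snd e ∈ G.neighbors (G.fst e) := mem_neighbors.2 ⟨e, Or.inl ⟨rfl, rfl⟩⟩
      exact ⟨_, this, Or.inr ⟨_, hv, this⟩⟩
    · have : G.fst e ∈ G.neighbors (G.snd e) := mem_neighbors.2 ⟨e, Or.inr ⟨rfl, rfl⟩⟩
      exact ⟨_, this, Or.inr ⟨_, hv, this⟩⟩
  · exact ⟨w, neighbors_symm hvw, Or.inl hw⟩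

theorem openEnded_empty (hG : ∀ v, 3 ≤ G.degree v) : G.OpenEnded ∅ := by
  intro v _
  obtain ⟨w, hw, -⟩ := openEnded_compl_closedNeighbors hG Finset.univ v (by simp [closedNeighbors])
  exact ⟨w, hw, by simp⟩

/-- A sink contributes at most its degree plus one to the closed neighbourhood; then expectation is
linear. -/
theorem sum_card_closedNeighbors_le (hG : ∀ v, 3 ≤ G.degree v) {S : Finset (Fin n)}
    (hS : G.OpenEnded S) :
    ∑ σ ∈ G.sinkFreeOn S, ((G.closedNeighbors (G.sinks σ)).card : ℝ) ≤
      25 / 32 * Sᶜ.card * (G.sinkFreeOn S).card := by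
  classical
  calc ∑ σ ∈ G.sinkFreeOn S, ((G.closedNeighbors (G.sinks σ)).card : ℝ)
      ≤ ∑ σ ∈ G.sinkFreeOn S, ∑ v ∈ Sᶜ, if G.IsSink σ v then (G.degree v : ℝ) + 1 else 0 := by
        refine Finset.sum_le_sum fun σ hσ => ?_
        have hsub : Sᶜ.filter (fun v => G.IsSink σ v) = G.sinks σ := by
          ext v
          simp only [Finset.mem_filter, Finset.mem_compl, mem_sinks, and_iff_right_iff_imp]
          exact fun h hv => mem_sinkFreeOn.1 hσ v hv h
        rw [← Finset.sum_filter, hsub]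
        have h : (G.closedNeighbors (G.sinks σ)).card ≤ ∑ v ∈ G.sinks σ, (G.degree v + 1) := by
          rw [Finset.sum_add_distrib, Finset.sum_const, smul_eq_mul, mul_one, add_comm]
          refine (Finset.card_union_le _ _).trans (add_le_add le_rfl ?_)
          exact Finset.card_biUnion_le.trans (Finset.sum_le_sum fun v _ => card_neighbors_le v)
        exact_mod_cast h
    _ = ∑ v ∈ Sᶜ, ((G.degree v : ℝ) + 1) * (G.sinkFreeOnWithSink S v).card := by
        rw [Finset.sum_comm]
        refine Finset.sum_congr rfl fun v _ => ?_
        rw [← Finset.sum_filter, Finset.sum_const, nsmul_eq_mul, mul_comm]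
        rfl
    _ ≤ ∑ v ∈ Sᶜ, 25 / 32 * ((G.sinkFreeOn S).card : ℝ) :=
        Finset.sum_le_sum fun v hv => succ_degree_mul_card_le hG hS (Finset.mem_compl.1 hv)
    _ = _ := by rw [Finset.sum_const, nsmul_eq_mul]; ring

/-- A lower bound for the probability of each sink-free orientation after `R` rounds started from the
uniform distribution on `G.sinkFreeOn S`. -/
theorem card_mul_le_sum_iterate (hG : ∀ v, 3 ≤ G.degree v) {τ : G.Orientation}
    (hτ : τ ∈ G.sinkFree) (R : ℕ) {S : Finset (Fin n)} (hS : G.OpenEnded S) :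
    (G.sinkFreeOn S).card * (1 - (25 / 32 : ℝ) ^ R * Sᶜ.card) ≤
      G.sinkFree.card * ∑ σ ∈ G.sinkFreeOn S, G.popSinks^[R] (Pi.single τ 1) σ := by
  classical
  induction R generalizing S with
  | zero =>
    rw [pow_zero, one_mul, Function.iterate_zero, id]
    -- If `S` is everything, the distribution is already the target; otherwise the claimed lower
    -- bound is not positive.
    rcases Sᶜ.eq_empty_or_nonempty with h | h
    · rw [Finset.compl_eq_empty_iff] at h
      subst h
      rw [sinkFreeOn_univ]
      simp [Pi.single_apply, hτ]
    · have h₁ : (1 : ℝ) ≤ Sᶜ.card := by exact_mod_cast h.card_pos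
      have h₂ : (0 : ℝ) ≤ (G.sinkFreeOn S).card := Nat.cast_nonneg _
      refine (mul_nonpos_of_nonneg_of_nonpos h₂ (by linarith)).trans ?_
      refine mul_nonneg (Nat.cast_nonneg _) (Finset.sum_nonneg fun σ _ => ?_)
      rw [Pi.single_apply]
      split_ifs <;> norm_num
  | succ R ih =>
    set f := G.popSinks^[R] (Pi.single τ 1) with hf
    rw [Function.iterate_succ_apply', ← hf]
    have key : ∑ σ ∈ G.sinkFreeOn S,
        (1 - (25 / 32 : ℝ) ^ R * (G.closedNeighbors (G.sinks σ)).card) ≤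
        G.sinkFree.card * ∑ σ ∈ G.sinkFreeOn S, G.popSinks f σ := by
      rw [← Finset.sum_fiberwise (G.sinkFreeOn S) G.sinks,
        ← Finset.sum_fiberwise (G.sinkFreeOn S) G.sinks (G.popSinks f), Finset.mul_sum]
      refine Finset.sum_le_sum fun J _ => ?_
      by_cases hJ : Disjoint J S
      · have hfib : (G.sinkFreeOn S).filter (fun σ => G.sinks σ = J) =
            Finset.univ.filter fun σ : G.Orientation => G.sinks σ = J := by
          ext σ
          simp only [Finset.mem_filter, Finset.mem_univ, true_and, and_iff_right_iff_imp]
          rintro rfl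
          rw [mem_sinkFreeOn]
          exact fun v hv h => Finset.disjoint_left.1 hJ (mem_sinks.2 h) hv
        rw [hfib]
        -- Given the sinks `J`, the next round starts from the complement of the closed
        -- neighbourhood, whose size becomes the new error term.
        have h₁ := ih (openEnded_compl_closedNeighbors hG J)
        rw [compl_compl] at h₁
        have h₂ := sum_popSinks_mul_card J f
        have hpos : (0 : ℝ) < (G.sinkFreeOn (G.closedNeighbors J)ᶜ).card := by
          exact_mod_cast (sinkFreeOn_nonempty hG _).card_pos
        have h₃ : ∑ σ with G.sinks σ = J,
            (1 - (25 / 32 : ℝ) ^ R * (G.closedNeighbors (G.sinks σ)).card) =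
            (Finset.univ.filter fun σ : G.Orientation => G.sinks σ = J).card *
              (1 - (25 / 32 : ℝ) ^ R * (G.closedNeighbors J).card) := by
          rw [← nsmul_eq_mul, ← Finset.sum_const]
          exact Finset.sum_congr rfl fun σ hσ => by rw [(Finset.mem_filter.1 hσ).2]
        rw [h₃]
        refine le_of_mul_le_mul_right ?_ hpos
        rw [mul_assoc _ (Finset.sum _ _), h₂]
        have h₄ := mul_le_mul_of_nonneg_left h₁ (Nat.cast_nonneg (α := ℝ)
          (Finset.univ.filter fun σ : G.Orientation => G.sinks σ = J).card)
        linarith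
      · have hfib : (G.sinkFreeOn S).filter (fun σ => G.sinks σ = J) = ∅ := by
          refine Finset.filter_eq_empty_iff.2 ?_
          rintro σ hσ rfl
          refine hJ (Finset.disjoint_left.2 fun v hv hvS => ?_)
          exact mem_sinkFreeOn.1 hσ v hvS (mem_sinks.1 hv)
        simp [hfib]
    refine le_trans ?_ key
    rw [Finset.sum_sub_distrib, ← Finset.mul_sum, Finset.sum_const, nsmul_eq_mul, mul_one]
    have h := mul_le_mul_of_nonneg_left (sum_card_closedNeighbors_le hG hS)
      (show (0 : ℝ) ≤ (25 / 32) ^ R by positivity)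
    rw [pow_succ]
    linarith

end EdgeListGraph

/-! ## Accuracy and running time -/

/-- Upper bounds are not needed, because both masses are one: |p - q| ≤ p - (1 - 2ε) q pointwise,
and the right side sums to 2ε. -/
theorem tvDist_le_of_mul_le {α : Type*} [Fintype α] (p q : PMF α) {ε : ℝ} (hε : 0 ≤ ε)
    (h : ∀ x, (1 - ε) * (q x).toReal ≤ (p x).toReal) : tvDist p q ≤ ε := by
  have hsum : ∀ r : PMF α, ∑ x, (r x).toReal = 1 := fun r => by
    rw [← ENNReal.toReal_sum fun x _ => r.apply_ne_top x, ← ENNReal.toReal_one, ← r.tsum_coe,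
      tsum_fintype]
  have hle : ∑ x, |(p x).toReal - (q x).toReal| ≤
      ∑ x, ((p x).toReal - (1 - 2 * ε) * (q x).toReal) := by
    refine Finset.sum_le_sum fun x _ => abs_le.2 ⟨?_, ?_⟩
    · linarith [h x]
    · have := mul_nonneg hε (ENNReal.toReal_nonneg (a := q x))
      linarith
  rw [Finset.sum_sub_distrib, ← Finset.mul_sum, hsum, hsum] at hle
  rw [tvDist]
  linarith

theorem exists_first_digit {ε : ℝ} (h0 : 0 < ε) (h1 : ε < 1) :
    ∃ D : ℕ, (∀ i < D, Real.digits ε 2 i = 0) ∧ Real.digits ε 2 D ≠ 0 ∧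
      1 ≤ ε * 2 ^ (D + 1) ∧ ε * 2 ^ D < 1 := by
  classical
  have hex : ∃ D : ℕ, 1 ≤ ε * 2 ^ (D + 1) := by
    obtain ⟨D, hD⟩ := pow_unbounded_of_one_lt (1 / ε) (one_lt_two)
    rw [div_lt_iff₀' h0] at hD
    refine ⟨D, hD.le.trans ?_⟩
    gcongr
    · norm_num
    · omega
  have hlt : ∀ i < Nat.find hex, ε * 2 ^ (i + 1) < 1 := fun i hi => not_le.1 (Nat.find_min hex hi)
  have hlt' : ε * 2 ^ Nat.find hex < 1 := by
    rcases Nat.eq_zero_or_pos (Nat.find hex) with h | h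
    · rw [h]; simpa using h1
    · obtain ⟨j, hj⟩ := Nat.exists_eq_add_of_le' h
      rw [hj]
      exact hlt j (by omega)
  refine ⟨Nat.find hex, fun i hi => ?_, ?_, Nat.find_spec hex, hlt'⟩
  · have : ⌊ε * ((2 : ℕ) : ℝ) ^ (i + 1)⌋₊ = 0 := Nat.floor_eq_zero.2 (by simpa using hlt i hi)
    rw [Real.digits, this]
    rfl
  · have : ⌊ε * ((2 : ℕ) : ℝ) ^ (Nat.find hex + 1)⌋₊ = 1 := by
      rw [Nat.floor_eq_iff (by positivity)]
      refine ⟨by simpa using Nat.find_spec hex, ?_⟩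
      rw [pow_succ]
      push_cast
      linarith
    rw [Real.digits, this]
    decide

theorem EdgeListGraph.sum_degree {n m : ℕ} (G : EdgeListGraph n m) :
    ∑ v, G.degree v = 2 * m := by
  have h : ∀ f : Fin m → Fin n, ∑ v, (Finset.univ.filter fun e => f e = v).card = m := fun f => by
    rw [← Finset.card_eq_sum_card_fiberwise (fun _ _ => Finset.mem_coe.2 (Finset.mem_univ _))]
    simp
  simp only [degree, Finset.sum_add_distrib, h]
  ring

theorem EdgeListGraph.three_mul_le {n m : ℕ} {G : EdgeListGraph n m} (hG : ∀ v, 3 ≤ G.degree v) :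
    3 * n ≤ 2 * m := by
  rw [← G.sum_degree]
  calc 3 * n = ∑ _v : Fin n, 3 := by simp [mul_comm]
    _ ≤ _ := Finset.sum_le_sum fun v _ => hG v

/-- With l = ⌈log₂ n⌉, 2^(l + D + 1) ≤ 4m/ε ≤ (m/ε)^3, as m/ε ≥ 2. Taking logarithms, log 2 > 1/2
turns the exponent 3 into the factor 6. -/
theorem clog_add_le_log {n m D : ℕ} {ε : ℝ} (hnm : n ≤ m) (hm : 2 ≤ m) (h0 : 0 < ε)
    (h1 : ε < 1) (hD : ε * 2 ^ D < 1) :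
    ((Nat.clog 2 n + D + 1 : ℕ) : ℝ) ≤ 6 * Real.log (m / ε) := by
  have hm' : (2 : ℝ) ≤ m := by exact_mod_cast hm
  have hx : 2 ≤ m / ε := by
    rw [le_div_iff₀ h0]
    nlinarith
  have hpow : (2 : ℝ) ^ Nat.clog 2 n ≤ 2 * m := by
    rcases Nat.eq_zero_or_pos (Nat.clog 2 n) with h | h
    · rw [h]; linarith
    · obtain ⟨j, hj⟩ := Nat.exists_eq_add_of_le' h
      have : 2 ^ j < n := Nat.pow_lt_of_lt_clog (by omega)
      rw [hj, pow_succ, mul_comm]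
      have : (2 : ℝ) ^ j ≤ m := by exact_mod_cast this.le.trans hnm
      linarith
  have hD' : (2 : ℝ) ^ D ≤ 1 / ε := by
    rw [le_div_iff₀ h0]; linarith
  have h : (2 : ℝ) ^ (Nat.clog 2 n + D + 1) ≤ (m / ε) ^ 3 := by
    calc (2 : ℝ) ^ (Nat.clog 2 n + D + 1) = 2 ^ Nat.clog 2 n * 2 ^ D * 2 := by ring
      _ ≤ 2 * m * (1 / ε) * 2 := by gcongr
      _ = 2 * 2 * (m / ε) := by ring
      _ ≤ (m / ε) * (m / ε) * (m / ε) := by gcongr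
      _ = _ := by ring
  have hlog := Real.log_le_log (by positivity) h
  rw [Real.log_pow, Real.log_pow] at hlog
  have h2 := Real.log_two_gt_d9
  have hL : (0 : ℝ) ≤ ((Nat.clog 2 n + D + 1 : ℕ) : ℝ) := Nat.cast_nonneg _
  push_cast at hlog hL ⊢
  nlinarith

/-- A round costs at most 69m, and 311 = 3·69 + 20 + 14 + 20 + 50. -/
theorem steps_le {n m l D : ℕ} (hnm : n ≤ m) (hm : 2 ≤ m) :
    (32 * m + 6 * n + 31) * (3 * (l + D + 1)) + (6 * n + 14) * l + 14 * D + 20 * m + 50 ≤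
      311 * (m * (l + D + 1)) := by
  have h₁ : (32 * m + 6 * n + 31) * (3 * (l + D + 1)) ≤ (69 * m) * (3 * (l + D + 1)) :=
    Nat.mul_le_mul_right _ (by omega)
  have h₂ : (6 * n + 14) * l ≤ (20 * m) * l := Nat.mul_le_mul_right _ (by omega)
  have h₃ : D ≤ m * D := Nat.le_mul_of_pos_left _ (by omega)
  nlinarith [Nat.zero_le (m * l)]

/-- Each triple of rounds gains a factor 1/2: `l` triples absorb `n`, and the remaining `D + 1`
bring the error below `ε`. -/
theorem pow_mul_le_of_le_two_pow {n l D : ℕ} {ε : ℝ} (hn : n ≤ 2 ^ l)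
    (hD : 1 ≤ ε * 2 ^ (D + 1)) : (25 / 32 : ℝ) ^ (3 * (l + D + 1)) * n ≤ ε := by
  have hn' : (n : ℝ) ≤ 2 ^ l := by exact_mod_cast hn
  calc (25 / 32 : ℝ) ^ (3 * (l + D + 1)) * n ≤ (1 / 2) ^ (l + D + 1) * 2 ^ l := by
        rw [pow_mul]
        gcongr
        norm_num
    _ = (1 / 2) ^ (D + 1) * ((1 / 2) ^ l * 2 ^ l) := by ring
    _ = (1 / 2) ^ (D + 1) := by rw [← mul_pow]; norm_num
    _ ≤ (1 / 2) ^ (D + 1) * (ε * 2 ^ (D + 1)) := le_mul_of_one_le_right (by positivity) hD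
    _ = ε * ((1 / 2) ^ (D + 1) * 2 ^ (D + 1)) := by ring
    _ = ε := by rw [← mul_pow]; norm_num

theorem SinkPopping.Holds.output_eq {n m r : ℕ} {G : EdgeListGraph n m} {σ : G.Orientation}
    {s : RAM.Store} (h : Holds G r σ s) (k : List RAM.Program) : G.output (k, s) = σ := by
  funext e
  rw [EdgeListGraph.output, h.orientation]
  cases σ e <;> rfl

theorem theorem2 :
    ∃ (p : RAM.Program) (C : ℝ), ∀ (n m : ℕ) (G : EdgeListGraph n m) (ε : ℝ),
      0 < n → (∀ v, 3 ≤ G.degree v) → 0 < ε → ε < 1 →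
      ∃ (hΩ : G.sinkFree.Nonempty) (t : ℕ),
        (t : ℝ) ≤ C * (m * Real.log (m / ε)) ∧
        (∀ c ∈ (RAM.run t ([p], G.input ε)).support, RAM.Halted c) ∧
        tvDist (G.outputDist ε p t) (PMF.uniformOfFinset G.sinkFree hΩ) ≤ ε := by
  refine ⟨SinkPopping.program, 311 * 6, fun n m G ε hn hG h0 h1 => ?_⟩
  have hΩ : G.sinkFree.Nonempty := by
    rw [← EdgeListGraph.sinkFreeOn_univ]
    exact EdgeListGraph.sinkFreeOn_nonempty hG _
  obtain ⟨D, hD, hD', hDε, hDε'⟩ := exists_first_digit h0 h1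
  have h3 := EdgeListGraph.three_mul_le hG
  have hrun := fun τ : G.Orientation => SinkPopping.attains_program (G := G) (o := G.output)
    (a := τ) hD hD' (f := Pi.single τ 1) fun ρ s hs => RAM.Attains.halted (by
      rw [hs.output_eq, PMF.pure_apply, Pi.single_apply]
      by_cases h : ρ = τ
      · simp [h]
      · simp [h])
  -- Halting does not involve the observed orientation, so any choice will do.
  refine ⟨hΩ, _, ?_, (hrun hΩ.choose).1, ?_⟩
  · have hlog := clog_add_le_log (n := n) (by omega) (by omega) h0 h1 hDε' (m := m)
    have hsteps := steps_le (n := n) (m := m) (l := Nat.clog 2 n) (D := D) (by omega) (by omega)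
    refine (Nat.cast_le.2 hsteps).trans ?_
    rw [Nat.cast_mul, Nat.cast_mul, mul_assoc]
    push_cast at hlog ⊢
    have := mul_le_mul_of_nonneg_left hlog (Nat.cast_nonneg (α := ℝ) m)
    linarith
  · refine tvDist_le_of_mul_le _ _ h0.le fun τ => ?_
    by_cases hτ : τ ∈ G.sinkFree
    · rw [PMF.uniformOfFinset_apply_of_mem _ hτ, ENNReal.toReal_inv, ENNReal.toReal_natCast]
      refine (ENNReal.ofReal_le_iff_le_toReal (PMF.apply_ne_top _ _)).1 ?_
      refine le_trans (ENNReal.ofReal_le_ofReal ?_) (hrun τ).2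
      have key := EdgeListGraph.card_mul_le_sum_iterate hG hτ (3 * (Nat.clog 2 n + D + 1))
        (EdgeListGraph.openEnded_empty hG)
      -- The uniform initial orientation is the case of the empty `S`, with error (25/32)^R n.
      have huniv : G.sinkFreeOn ∅ = Finset.univ := by simp [EdgeListGraph.sinkFreeOn]
      rw [huniv, Finset.compl_empty, Finset.card_univ, Finset.card_univ, Fintype.card_fin,
        Fintype.card_pi] at key
      simp only [Fintype.card_bool, Finset.prod_const, Finset.card_univ, Fintype.card_fin] at key
      have herr := pow_mul_le_of_le_two_pow (Nat.le_pow_clog one_lt_two n) hDε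
      have hZ : (0 : ℝ) < G.sinkFree.card := by exact_mod_cast hΩ.card_pos
      rw [← div_eq_mul_inv, div_le_div_iff₀ hZ (by positivity)]
      push_cast at key
      refine le_trans ?_ (key.trans_eq (mul_comm _ _))
      rw [mul_comm]
      gcongr
    · rw [PMF.uniformOfFinset_apply_of_notMem _ hτ]
      simp
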